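/- Let $n$ be a number of qubits, let $k, d_e \ge 1$ be integers and let $c_e \ge 1$ be real. For $P = P_1 \otimes \cdots \otimes P_n \in \{I,X,Y,Z\}^{\otimes n}$ let $\mathsf{dom}(P) = \{i : P_i \ne I\}$ be the set of qubits on which $P$ acts nontrivially and $|P| = |\mathsf{dom}(P)|$. Let $H$ be an $n$-qubit $k$-local Hamiltonian, that is, a Hermitian operator on $(\mathbb{C}^2)^{\otimes n}$ of the form $H = \sum_{P : |P| \le k} \alpha_P P$ (so $\alpha_P = 2^{-n}\operatorname{Tr}(PH)$). Suppose that $H$ has expansion coefficient $c_e$ and expansion dimension $d_e$, that is, for every $\Upsilon \subseteq \{1,\dots,n\}$ with $|\Upsilon| = d_e$, $$\#\{P \in \{I,X,Y,Z\}^{\otimes n} : \alpha_P \ne 0 \text{ and } (\Upsilon \subseteq \mathsf{dom}(P) \text{ or } \mathsf{dom}(P) \subseteq \Upsilon)\} \le c_e .$$ Put $r = 2d_e/(d_e+1)$, and let $\|H\|_{\mathrm{Pauli},r} = \big(\sum_P |\alpha_P|^r\big)^{1/r}$ and $\|H\|$ be the spectral norm of $H$. Then $r \in [1,2)$ and $$\frac13\,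 C(c_e,d_e,k)\, \|H\|_{\mathrm{Pauli},r} \le \|H\|, \qquad C(c_e,d_e,k) = \frac{\sqrt{2\,(k!)}}{c_e^{1/(2d_e)}\, k^{k+1.5+1/r}\, (\sqrt6+2\sqrt3)^k}.$$ -/

import Mathlib

namespace PauliNorm

/-- The four labels of the single-qubit Pauli matrices. -/
inductive Pauli
  | I | X | Y | Z
  deriving DecidableEq

instance : Fintype Pauli where
  elems := {Pauli.I, Pauli.X, Pauli.Y, Pauli.Z}
  complete p := by cases p <;> simp

/-- The single-qubit Pauli matrices. -/
def Pauli.toMatrix : Pauli → Matrix (Fin 2) (Fin 2) ℂ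
  | .I => !![1, 0; 0, 1]
  | .X => !![0, 1; 1, 0]
  | .Y => !![0, -Complex.I; Complex.I, 0]
  | .Z => !![1, 0; 0, -1]

/-- The labels in `{I, X, Y, Z}^{⊗ n}`. -/
abbrev PauliString (n : ℕ) := Fin n → Pauli

/-- The operators on `n` qubits, as matrices over the computational basis `{0, 1}^n`. -/
abbrev QubitOp (n : ℕ) := Matrix (Fin n → Fin 2) (Fin n → Fin 2) ℂ

/-- The `n`-qubit Pauli observable `P_1 ⊗ ⋯ ⊗ P_n`. -/
def pauliOp {n : ℕ} (P : PauliString n) : QubitOp n :=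
  Matrix.of fun x y => ∏ i, (P i).toMatrix (x i) (y i)

/-- The set `dom(P)` of qubits on which `P` acts nontrivially; `|P|` is its cardinality. -/
def dom {n : ℕ} (P : PauliString n) : Finset (Fin n) :=
  Finset.univ.filter fun i => P i ≠ Pauli.I

/-- The coefficient `α_P = Tr(P H) / 2^n` of `P` in the Pauli expansion of `H`
(see `sum_pauliCoeff_smul` and `pauliCoeff_sum`). -/
noncomputable def pauliCoeff {n : ℕ} (H : QubitOp n) (P : PauliString n) : ℂ :=
  (pauliOp P * H).trace / 2 ^ n

theorem pauli_complete (a b c d : Fin 2) :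
    ∑ p : Pauli, p.toMatrix a b * p.toMatrix c d = if a = d ∧ b = c then 2 else 0 := by
  have h : (Finset.univ : Finset Pauli) = {Pauli.I, Pauli.X, Pauli.Y, Pauli.Z} := rfl
  rw [h]
  fin_cases a <;> fin_cases b <;> fin_cases c <;> fin_cases d <;>
    simp [Pauli.toMatrix] <;> norm_num

theorem pauli_orthogonal (p q : Pauli) :
    ∑ a : Fin 2, ∑ b : Fin 2, p.toMatrix a b * q.toMatrix b a = if p = q then 2 else 0 := by
  cases p <;> cases q <;> simp [Pauli.toMatrix, Fin.sum_univ_two] <;> norm_num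

/-- Every operator is the combination of the Pauli observables with coefficients `pauliCoeff`. -/
theorem sum_pauliCoeff_smul {n : ℕ} (H : QubitOp n) :
    ∑ P : PauliString n, pauliCoeff H P • pauliOp P = H := by
  have key (x y u v : Fin n → Fin 2) :
      ∑ P : PauliString n, pauliOp P u v * pauliOp P x y
        = if u = y ∧ v = x then (2 : ℂ) ^ n else 0 := by
    simp only [pauliOp, Matrix.of_apply, ← Finset.prod_mul_distrib]
    rw [← Fintype.prod_sum (fun i (p : Pauli) =>
      p.toMatrix (u i) (v i) * p.toMatrix (x i) (y i))]
    simp only [pauli_complete]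
    by_cases h : u = y ∧ v = x
    · rw [if_pos h]; simp [h.1, h.2]
    · rw [if_neg h]
      have : ∃ i, ¬ (u i = y i ∧ v i = x i) := by
        by_contra hc
        push Not at hc
        exact h ⟨funext fun i => (hc i).1, funext fun i => (hc i).2⟩
      obtain ⟨i, hi⟩ := this
      exact Finset.prod_eq_zero (Finset.mem_univ i) (if_neg hi)
  ext x y
  simp only [Matrix.sum_apply, Matrix.smul_apply, smul_eq_mul, pauliCoeff, Matrix.trace,
    Matrix.diag_apply, Matrix.mul_apply]
  have h2 : ∀ P : PauliString n,
      (∑ u, ∑ v, pauliOp P u v * H v u) / 2 ^ n * pauliOp P x y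
        = ∑ u, ∑ v, (pauliOp P u v * pauliOp P x y) * (H v u / 2 ^ n) := by
    intro P
    rw [Finset.sum_div, Finset.sum_mul]
    refine Finset.sum_congr rfl fun u _ => ?_
    rw [Finset.sum_div, Finset.sum_mul]
    exact Finset.sum_congr rfl fun v _ => by ring
  simp only [h2]
  rw [Finset.sum_comm]
  have h3 : ∀ u : Fin n → Fin 2,
      ∑ P : PauliString n, ∑ v, (pauliOp P u v * pauliOp P x y) * (H v u / 2 ^ n)
        = ∑ v, (if u = y ∧ v = x then (2 : ℂ) ^ n else 0) * (H v u / 2 ^ n) := by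
    intro u
    rw [Finset.sum_comm]
    refine Finset.sum_congr rfl fun v _ => ?_
    rw [← Finset.sum_mul, key]
  simp only [h3]
  rw [Finset.sum_eq_single y, Finset.sum_eq_single x]
  · simp only [and_self, if_true]
    field_simp
  · intro v _ hv; simp [hv]
  · simp
  · intro u _ hu; simp [hu]
  · simp

/-- The coefficients of the Pauli expansion are unique. -/
theorem pauliCoeff_sum {n : ℕ} (α : PauliString n → ℂ) (Q : PauliString n) :
    pauliCoeff (∑ P, α P • pauliOp P) Q = α Q := by
  have key (P : PauliString n) :
      (pauliOp Q * pauliOp P).trace = if Q = P then (2 : ℂ) ^ n else 0 := by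
    simp only [Matrix.trace, Matrix.diag_apply, Matrix.mul_apply, pauliOp, Matrix.of_apply,
      ← Finset.prod_mul_distrib]
    have h1 : ∀ x : Fin n → Fin 2,
        ∑ y : Fin n → Fin 2, ∏ i, (Q i).toMatrix (x i) (y i) * (P i).toMatrix (y i) (x i)
          = ∏ i, ∑ b, (Q i).toMatrix (x i) b * (P i).toMatrix b (x i) := fun x =>
      (Fintype.prod_sum (fun i b => (Q i).toMatrix (x i) b * (P i).toMatrix b (x i))).symm
    simp only [h1]
    rw [← Fintype.prod_sum (fun i a => ∑ b, (Q i).toMatrix a b * (P i).toMatrix b a)]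
    simp only [pauli_orthogonal]
    by_cases h : Q = P
    · simp [h]
    · rw [if_neg h]
      obtain ⟨i, hi⟩ := Function.ne_iff.mp h
      exact Finset.prod_eq_zero (Finset.mem_univ i) (if_neg hi)
  simp only [pauliCoeff, Matrix.mul_sum, Matrix.trace_sum, Matrix.mul_smul, Matrix.trace_smul,
    key, smul_eq_mul]
  simp

/-- An `n`-qubit `k`-local Hamiltonian: a Hermitian operator `∑_{P : |P| ≤ k} α_P P`. -/
def IsLocalHamiltonian {n : ℕ} (H : QubitOp n) (k : ℕ) : Prop :=
  H.IsHermitian ∧ ∀ P : PauliString n, pauliCoeff H P ≠ 0 → (dom P).card ≤ k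

open Classical in
/-- `H` has expansion coefficient `c` and expansion dimension `d`: for every set `S` of `d` qubits,
at most `c` Pauli strings `P` with `α_P ≠ 0` satisfy `S ⊆ dom(P)` or `dom(P) ⊆ S`. -/
def HasExpansion {n : ℕ} (H : QubitOp n) (c : ℝ) (d : ℕ) : Prop :=
  ∀ S : Finset (Fin n), S.card = d →
    ((Finset.univ.filter fun P : PauliString n =>
      pauliCoeff H P ≠ 0 ∧ (S ⊆ dom P ∨ dom P ⊆ S)).card : ℝ) ≤ c

/-- The Pauli-`p` norm `(∑_P |α_P|^p)^{1/p}`. -/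
noncomputable def pauliNorm {n : ℕ} (H : QubitOp n) (p : ℝ) : ℝ :=
  (∑ P : PauliString n, ‖pauliCoeff H P‖ ^ p) ^ (1 / p)

/-- The spectral norm: the operator norm on `ℂ^{2^n}` with its Euclidean norm. -/
noncomputable def opNorm {n : ℕ} (H : QubitOp n) : ℝ :=
  ‖Matrix.toEuclideanCLM (n := Fin n → Fin 2) (𝕜 := ℂ) H‖

/-- The exponent `r = 2 d / (d + 1)`. -/
noncomputable def expansionExponent (d : ℕ) : ℝ := 2 * (d : ℝ) / ((d : ℝ) + 1)

/-- The constant `C(c, d, k) = √(2 (k!)) / (c^{1/(2d)} k^{k + 1.5 + 1/r} (√6 + 2√3)^k)`, with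
`r = 2 d / (d + 1)`. -/
noncomputable def expansionConst (c : ℝ) (d k : ℕ) : ℝ :=
  Real.sqrt (2 * (k.factorial : ℝ)) /
    (c ^ (1 / (2 * (d : ℝ))) * (k : ℝ) ^ ((k : ℝ) + 3 / 2 + 1 / expansionExponent d) *
      (Real.sqrt 6 + 2 * Real.sqrt 3) ^ k)

end PauliNorm

namespace PauliNorm

open Finset
open scoped BigOperators

/-! The energy of `H` in a product state with Bloch vectors `v i` is `∑ α_P ∏_{i ∈ dom P} v i (P
i)`. When all Bloch coordinates range over `[-1/√3, 1/√3]`, every choice is a legitimate state, so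
after rescaling one gets a multilinear polynomial `f` of degree at most `k` in variables indexed by
(qubit, letter), with coefficients `α_P 3^{-|P|/2}` and `|f| ≤ ‖H‖` on the cube `[-1, 1]`.

Markov's inequality on line segments bounds `∑ |∂_j f|` by `4 k² ‖H‖` on the half cube
(`sum_abs_multilinDeriv_le`). Hypercontractivity lets the `L¹` norm of each `∂_j f` control its `L²`
norm (`sqrt_sum_sq_le_expect_abs`). Together they bound `A = ∑_i (∑_{P ∋ i} |α_P|²)^{1/2}` by a
constant depending on `k` times `‖H‖` (`sum_sqrt_sum_norm_pauliCoeff_sq_le`).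

A Blei-type inequality (`sum_rpow_le_of_card_fiber_le`) passes from `A` to the `ℓ^r` norm: each `P`
is tagged by a `d`-tuple in `dom P`, and the expansion hypothesis says that few strings share a tag.
If `d > n` the hypothesis is void, but there are only `4^n` coefficients and an `ℓ²` bound suffices.
The constants so obtained are better than the claimed one. -/

/-- The sign `±1` encoded by a Boolean. -/
def boolSign (b : Bool) : ℝ := if b then 1 else -1

theorem boolSign_not (b : Bool) : boolSign (!b) = -boolSign b := by cases b <;> simp [boolSign]

theorem boolSign_mul_self (b : Bool) : boolSign b * boolSign b = 1 := by
  cases b <;> simp [boolSign]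

theorem abs_boolSign (b : Bool) : |boolSign b| = 1 := by cases b <;> simp [boolSign]

/-! ### Walsh polynomials on the discrete cube: moments and hypercontractivity. -/

section Boolean

variable {ι : Type*} [DecidableEq ι]

/-- The Walsh character of the set `S` on the discrete cube. -/
def walsh (S : Finset ι) (e : ι → Bool) : ℝ := ∏ i ∈ S, boolSign (e i)

/-- The point of the cube obtained from `e` by flipping the coordinate `a`. -/
def flipAt (a : ι) (e : ι → Bool) : ι → Bool := Function.update e a (!e a)

theorem flipAt_flipAt (a : ι) (e : ι → Bool) : flipAt a (flipAt a e) = e := by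
  simp [flipAt]

theorem walsh_insert {a : ι} {S : Finset ι} (ha : a ∉ S) (e : ι → Bool) :
    walsh (insert a S) e = boolSign (e a) * walsh S e := by
  simp [walsh, prod_insert ha]

theorem walsh_flipAt {a : ι} {S : Finset ι} (ha : a ∉ S) (e : ι → Bool) :
    walsh S (flipAt a e) = walsh S e := by
  refine prod_congr rfl fun i hi => ?_
  have : i ≠ a := fun h => ha (h ▸ hi)
  simp [flipAt, this]

/-- The restriction of a Walsh polynomial to the characters of subsets of `U`. -/
def walshSum (U : Finset ι) (c : Finset ι → ℝ) (e : ι → Bool) : ℝ :=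
  ∑ S ∈ U.powerset, c S * walsh S e

theorem walshSum_insert {a : ι} {U : Finset ι} (ha : a ∉ U) (c : Finset ι → ℝ) (e : ι → Bool) :
    walshSum (insert a U) c e =
      walshSum U c e + boolSign (e a) * walshSum U (fun S => c (insert a S)) e := by
  simp only [walshSum]
  rw [sum_powerset_insert ha, mul_sum]
  congr 1
  refine sum_congr rfl fun S hS => ?_
  rw [walsh_insert (fun h => ha (mem_powerset.1 hS h))]
  ring

theorem walshSum_flipAt {a : ι} {U : Finset ι} (ha : a ∉ U) (c : Finset ι → ℝ) (e : ι → Bool) :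
    walshSum U c (flipAt a e) = walshSum U c e :=
  sum_congr rfl fun S hS => by rw [walsh_flipAt (fun h => ha (mem_powerset.1 hS h))]

variable [Fintype ι]

/-- Flipping the coordinate `a` preserves the uniform measure and reverses the sign of the
integrand. In the inductions on `U` below, this removes the terms odd in `e a`. -/
theorem expect_boolSign_mul (a : ι) (g : (ι → Bool) → ℝ) (hg : ∀ e, g (flipAt a e) = g e) :
    𝔼 e, boolSign (e a) * g e = 0 := by
  have h : 𝔼 e, boolSign (e a) * g e = 𝔼 e, -(boolSign (e a) * g e) := by
    refine Fintype.expect_equiv (Function.Involutive.toPerm (flipAt a) (flipAt_flipAt a)) _ _ ?_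
    intro e
    have ha : boolSign (flipAt a e a) = -boolSign (e a) := by simp [flipAt, boolSign_not]
    simp [Function.Involutive.toPerm, hg, ha]
  rw [expect_neg_distrib] at h
  linarith

theorem expect_walshSum_sq (U : Finset ι) (c : Finset ι → ℝ) :
    𝔼 e, walshSum U c e ^ 2 = ∑ S ∈ U.powerset, c S ^ 2 := by
  induction U using Finset.induction_on generalizing c with
  | empty => simp [walshSum, walsh]
  | insert a U ha ih =>
    have h : ∀ e, walshSum (insert a U) c e ^ 2 = walshSum U c e ^ 2 +
        walshSum U (fun S => c (insert a S)) e ^ 2 +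
        boolSign (e a) * (2 * walshSum U c e * walshSum U (fun S => c (insert a S)) e) := by
      intro e
      rw [walshSum_insert ha]
      linear_combination (walshSum U (fun S => c (insert a S)) e) ^ 2 * boolSign_mul_self (e a)
    simp only [h]
    rw [expect_add_distrib, expect_add_distrib, expect_boolSign_mul, ih, ih,
      sum_powerset_insert ha, add_zero]
    intro e
    simp only [walshSum_flipAt ha]

/-- The `(2, 4)` hypercontractive inequality on the discrete cube. -/
theorem expect_walshSum_pow_four_le (U : Finset ι) (c : Finset ι → ℝ) :
    𝔼 e, walshSum U c e ^ 4 ≤ (∑ S ∈ U.powerset, 3 ^ #S * c S ^ 2) ^ 2 := by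
  induction U using Finset.induction_on generalizing c with
  | empty => simp [walshSum, walsh]; exact le_of_eq (by ring)
  | insert a U ha ih =>
    set c' : Finset ι → ℝ := fun S => c (insert a S) with hc'
    have h : ∀ e, walshSum (insert a U) c e ^ 4 = walshSum U c e ^ 4 +
        6 * (walshSum U c e ^ 2 * walshSum U c' e ^ 2) + walshSum U c' e ^ 4 +
        boolSign (e a) * (4 * walshSum U c e ^ 3 * walshSum U c' e +
          4 * walshSum U c e * walshSum U c' e ^ 3) := by
      intro e
      rw [walshSum_insert ha]
      linear_combination (6 * walshSum U c e ^ 2 * walshSum U c' e ^ 2 +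
        4 * walshSum U c e * walshSum U c' e ^ 3 * boolSign (e a) +
        walshSum U c' e ^ 4 * (boolSign (e a) ^ 2 + 1)) * boolSign_mul_self (e a)
    simp only [h]
    rw [expect_add_distrib, expect_add_distrib, expect_add_distrib, expect_boolSign_mul,
      ← mul_expect, sum_powerset_insert ha, add_zero]
    swap
    · intro e
      simp only [walshSum_flipAt ha]
    set G := ∑ S ∈ U.powerset, 3 ^ #S * c S ^ 2
    set G' := ∑ S ∈ U.powerset, 3 ^ #S * c' S ^ 2 with hG'
    have h3 : ∑ S ∈ U.powerset, (3 : ℝ) ^ #(insert a S) * c (insert a S) ^ 2 = 3 * G' := by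
      rw [hG', mul_sum]
      refine sum_congr rfl fun S hS => ?_
      rw [card_insert_of_notMem (fun h => ha (mem_powerset.1 hS h)), pow_succ]
      ring
    have hG0 : 0 ≤ G := sum_nonneg fun _ _ => by positivity
    have hG0' : 0 ≤ G' := sum_nonneg fun _ _ => by positivity
    have h1 : 𝔼 e, walshSum U c e ^ 4 ≤ G ^ 2 := ih c
    have h2 : 𝔼 e, walshSum U c' e ^ 4 ≤ G' ^ 2 := ih c'
    have hcs : 𝔼 e, walshSum U c e ^ 2 * walshSum U c' e ^ 2 ≤ G * G' := by
      refine le_of_sq_le_sq ?_ (by positivity)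
      refine (expect_mul_sq_le_sq_mul_sq _ _ _).trans ?_
      simp only [← pow_mul]
      norm_num
      rw [mul_pow]
      exact mul_le_mul h1 h2 (expect_nonneg fun _ _ => by positivity) (by positivity)
    rw [h3]
    -- The numerical core: `G² + 6GG' + G'² ≤ (G + 3G')²`.
    nlinarith [mul_nonneg hG0 hG0']

/-- A Walsh polynomial of degree at most `m` has comparable first and second moments. -/
theorem sqrt_sum_sq_le_expect_abs (m : ℕ) (c : Finset ι → ℝ) (hc : ∀ S, c S ≠ 0 → #S ≤ m) :
    √(∑ S, c S ^ 2) ≤ 3 ^ m * 𝔼 e, |∑ S, c S * walsh S e| := by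
  have h2 := expect_walshSum_sq univ c
  have h4 := expect_walshSum_pow_four_le univ c
  simp only [walshSum, powerset_univ] at h2 h4
  set f : (ι → Bool) → ℝ := fun e => ∑ S, c S * walsh S e with hf
  set σ := √(∑ S, c S ^ 2) with hσ
  have hσ2 : σ ^ 2 = ∑ S, c S ^ 2 := Real.sq_sqrt (sum_nonneg fun _ _ => sq_nonneg _)
  rcases (Real.sqrt_nonneg (∑ S, c S ^ 2)).eq_or_lt with h0 | h0
  · rw [hσ, ← h0]
    exact mul_nonneg (by positivity) (expect_nonneg fun _ _ => abs_nonneg _)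
  rw [← hσ] at h0
  set t : ℝ := 3 ^ m with ht
  have ht0 : 0 < t := by positivity
  have h9 : ∑ S, 3 ^ #S * c S ^ 2 ≤ t * σ ^ 2 := by
    rw [hσ2, mul_sum]
    refine sum_le_sum fun S _ => ?_
    by_cases h : c S = 0
    · simp [h]
    · exact mul_le_mul_of_nonneg_right (pow_le_pow_right₀ (by norm_num) (hc S h)) (sq_nonneg _)
  have h4' : 𝔼 e, f e ^ 4 ≤ t ^ 2 * σ ^ 4 := by
    refine h4.trans ((pow_le_pow_left₀ (sum_nonneg fun _ _ => by positivity) h9 2).trans ?_)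
    exact le_of_eq (by ring)
  -- With `s = tσ` and `y = |f e|` this is `y (y - s)² (y + 2s) ≥ 0`. Averaged, it bounds the first
  -- moment below by the second and fourth moments.
  have hpt : ∀ e, 3 / 2 * (t * σ) ^ 2 * f e ^ 2 - 1 / 2 * f e ^ 4 ≤ (t * σ) ^ 3 * |f e| := by
    intro e
    have hs : 0 < t * σ := by positivity
    have hy := abs_nonneg (f e)
    have e2 : f e ^ 2 = |f e| ^ 2 := (sq_abs _).symm
    have e4 : f e ^ 4 = |f e| ^ 4 := by rw [show (4 : ℕ) = 2 * 2 from rfl, pow_mul, pow_mul, sq_abs]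
    rw [e2, e4]
    set y := |f e|
    set s := t * σ
    have : 0 ≤ y * ((y - s) ^ 2 * (y + 2 * s)) := by positivity
    nlinarith
  have hE := expect_le_expect (s := univ) fun e _ => hpt e
  rw [expect_sub_distrib, ← mul_expect, ← mul_expect, ← mul_expect] at hE
  have h2' : 𝔼 e, f e ^ 2 = σ ^ 2 := by rw [hσ2, ← h2]
  rw [h2'] at hE
  have h5 : (t * σ) ^ 2 * σ ^ 2 ≤ (t * σ) ^ 3 * 𝔼 e, |f e| := by nlinarith
  have h6 : 0 < (t * σ) ^ 2 * σ := by positivity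
  refine le_of_mul_le_mul_left ?_ h6
  nlinarith

end Boolean

/-! ### Markov's inequality and derivatives of bounded multilinear polynomials. -/

open Polynomial in
/-- Markov's inequality at the endpoint `1`. -/
theorem abs_derivative_eval_one_le {k : ℕ} {q : ℝ[X]} {M : ℝ} (hq : q.natDegree ≤ k)
    (hM : ∀ s ∈ Set.Icc (-1 : ℝ) 1, |q.eval s| ≤ M) :
    |(derivative q).eval 1| ≤ k ^ 2 * M := by
  have key : ∀ (p : ℝ[X]) (M : ℝ), 0 < M → p.natDegree ≤ k →
      (∀ s ∈ Set.Icc (-1 : ℝ) 1, |p.eval s| ≤ M) → (derivative p).eval 1 ≤ k ^ 2 * M := by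
    intro p M hM0 hp hpM
    -- Chebyshev polynomials are extremal, and `T_k'(1) = k²`.
    have h := Polynomial.Chebyshev.eval_iterate_derivative_le_of_forall_abs_le_one (n := k)
      (P := C M⁻¹ * p) (k := 1) (x := 1) le_rfl ?_ ?_
    · simp only [Function.iterate_one, Chebyshev.derivative_T_eval_one, derivative_C_mul,
        eval_mul, eval_C] at h
      rw [inv_mul_le_iff₀ hM0] at h
      simpa [mul_comm] using h
    · exact natDegree_le_iff_degree_le.1 ((natDegree_C_mul_le _ _).trans hp)
    · intro x hx
      rw [eval_mul, eval_C, abs_mul, abs_of_pos (inv_pos.2 hM0), inv_mul_le_iff₀ hM0, mul_one]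
      exact hpM x hx
  have key' : ∀ (p : ℝ[X]), p.natDegree ≤ k →
      (∀ s ∈ Set.Icc (-1 : ℝ) 1, |p.eval s| ≤ M) → (derivative p).eval 1 ≤ k ^ 2 * M := by
    intro p hp hpM
    have hM0 : 0 ≤ M := (abs_nonneg _).trans (hpM 0 (by norm_num))
    refine le_of_forall_pos_le_add fun ε hε => ?_
    -- The perturbation makes the bound positive, so that `p` can be normalised even if `M = 0`.
    have h := key p (M + ε / (k ^ 2 + 1)) (by positivity) hp fun s hs =>
      (hpM s hs).trans (le_add_of_nonneg_right (by positivity))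
    refine h.trans ?_
    rw [mul_add]
    gcongr
    rw [mul_div_assoc', div_le_iff₀ (by positivity)]
    nlinarith
  refine abs_le'.2 ⟨key' q hq hM, ?_⟩
  have := key' (-q) (by simpa using hq) (fun s hs => by simpa using hM s hs)
  simpa using this

section Boolean

variable {ι : Type*} [DecidableEq ι] [Fintype ι]

/-- The multilinear polynomial with coefficients `a`. -/
def multilin (a : Finset ι → ℝ) (x : ι → ℝ) : ℝ := ∑ S, a S * ∏ i ∈ S, x i

/-- The partial derivative of a multilinear polynomial. -/
def multilinDeriv (a : Finset ι → ℝ) (i : ι) (x : ι → ℝ) : ℝ :=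
  ∑ S with i ∈ S, a S * ∏ j ∈ S.erase i, x j

/-- Parseval at the vertices of the cube. -/
theorem sum_sq_le_of_abs_multilin_le {a : Finset ι → ℝ} {M : ℝ}
    (hM : ∀ x : ι → ℝ, (∀ i, |x i| ≤ 1) → |multilin a x| ≤ M) : ∑ S, a S ^ 2 ≤ M ^ 2 := by
  have h := expect_walshSum_sq univ a
  rw [powerset_univ] at h
  rw [← h]
  refine expect_le univ_nonempty fun e _ => ?_
  refine sq_le_sq' ?_ ?_ <;>
  · have := abs_le.1 (hM (fun i => boolSign (e i)) fun i => (abs_boolSign _).le)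
    simp only [multilin] at this
    simp only [walshSum, powerset_univ, walsh]
    linarith [this.1, this.2]

-- Restrict to the segment `y + (1 - s)/4 · v`, where `v` is the sign vector of the gradient at `y`.
-- For `s ∈ [-1, 1]` the displacement is at most `1/2`, so the segment stays in the unit cube. At `s
-- = 1` the derivative is `-1/4` of the `ℓ¹` norm of the gradient, and Markov applies.
open Polynomial in
theorem sum_abs_multilinDeriv_le {a : Finset ι → ℝ} {k : ℕ} {M : ℝ}
    (hk : ∀ S, a S ≠ 0 → #S ≤ k)
    (hM : ∀ x : ι → ℝ, (∀ i, |x i| ≤ 1) → |multilin a x| ≤ M)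
    (y : ι → ℝ) (hy : ∀ i, |y i| ≤ 1 / 2) :
    ∑ i, |multilinDeriv a i y| ≤ 4 * k ^ 2 * M := by
  have hv : ∀ i, ∃ v : ℝ, |v| ≤ 1 ∧ |multilinDeriv a i y| = v * multilinDeriv a i y := by
    intro i
    rcases abs_cases (multilinDeriv a i y) with h | h
    · exact ⟨1, by simp, by simp [h.1]⟩
    · exact ⟨-1, by simp, by simp [h.1]⟩
  choose v hv1 hv2 using hv
  let l : ι → ℝ[X] := fun i => C (y i + v i / 4) - C (v i / 4) * X
  let q : ℝ[X] := ∑ S, C (a S) * ∏ i ∈ S, l i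
  have hl : ∀ i s, (l i).eval s = y i + (1 - s) / 4 * v i := by
    intro i s
    simp only [l, eval_sub, eval_C, eval_mul, eval_X]
    ring
  have hq : ∀ s, q.eval s = multilin a fun i => y i + (1 - s) / 4 * v i := by
    intro s
    simp only [q, multilin, eval_finsetSum, eval_mul, eval_C, eval_prod, hl]
  have hdeg : q.natDegree ≤ k := by
    refine natDegree_sum_le_of_forall_le _ _ fun S _ => ?_
    by_cases h : a S = 0
    · simp [h]
    · refine (natDegree_C_mul_le _ _).trans ((natDegree_prod_le _ _).trans ?_)
      refine (sum_le_card_nsmul _ _ 1 fun i _ => ?_).trans (by simpa using hk S h)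
      refine (natDegree_sub_le _ _).trans (max_le (by simp) ?_)
      exact (natDegree_C_mul_le _ _).trans natDegree_X_le
  have hd : (derivative q).eval 1 = -(∑ i, |multilinDeriv a i y|) / 4 := by
    have hl' : ∀ i, (derivative (l i)).eval 1 = -v i / 4 := by
      intro i
      simp [l, neg_div]
    rw [sum_congr rfl fun i _ => hv2 i]
    simp only [q, derivative_sum, derivative_C_mul, derivative_prod_finset, eval_finsetSum,
      eval_mul, eval_C, eval_prod, hl', hl, multilinDeriv, sub_self, zero_div, zero_mul,
      add_zero, mul_sum, sum_filter]
    rw [← sum_neg_distrib, sum_div]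
    have h1 : ∀ S : Finset ι, ∑ i ∈ S, a S * ((∏ j ∈ S.erase i, y j) * (-v i / 4)) =
        ∑ i, if i ∈ S then a S * ((∏ j ∈ S.erase i, y j) * (-v i / 4)) else 0 := by
      intro S
      simp
    simp only [h1]
    rw [sum_comm]
    refine sum_congr rfl fun i _ => ?_
    rw [← sum_neg_distrib, sum_div]
    refine sum_congr rfl fun S _ => ?_
    split_ifs <;> ring
  have h := abs_derivative_eval_one_le hdeg (M := M) fun s hs => by
    rw [hq]
    refine hM _ fun i => ?_
    have h1 : |(1 - s) / 4 * v i| ≤ 1 / 2 * 1 := by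
      rw [abs_mul]
      refine mul_le_mul ?_ (hv1 i) (abs_nonneg _) (by norm_num)
      rw [abs_le]
      constructor <;> linarith [hs.1, hs.2]
    linarith [abs_add_le (y i) ((1 - s) / 4 * v i), hy i]
  rw [hd, neg_div, abs_neg] at h
  linarith [le_abs_self ((∑ i, |multilinDeriv a i y|) / 4)]

/-- Average the gradient bound over the points `e / 2`, with `e` a random sign vector. Each partial
derivative has degree at most `k - 1`: comparing `L²` with `L¹` costs `3^(k-1)`, and undoing the
scaling by `1/2` costs `2^(k-1)`. -/
theorem sum_sqrt_le_of_abs_multilin_le {a : Finset ι → ℝ} {k : ℕ} {M : ℝ}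
    (hk : ∀ S, a S ≠ 0 → #S ≤ k)
    (hM : ∀ x : ι → ℝ, (∀ i, |x i| ≤ 1) → |multilin a x| ≤ M) :
    ∑ i, √(∑ S with i ∈ S, a S ^ 2) ≤ 4 * k ^ 2 * 6 ^ (k - 1) * M := by
  -- Walsh coefficients of `e ↦ ∂_i f (e / 2)`; those with `i ∈ T` vanish because `∂_i f` does not
  -- involve `x i`.
  let b : ι → Finset ι → ℝ := fun i T => if i ∈ T then 0 else a (insert i T) * (1 / 2) ^ #T
  have hre : ∀ (i : ι) (f : Finset ι → ℝ),
      ∑ T, (if i ∈ T then 0 else f (insert i T)) = ∑ S with i ∈ S, f S := by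
    intro i f
    have h : ∑ T, (if i ∈ T then 0 else f (insert i T)) = ∑ T with i ∉ T, f (insert i T) := by
      rw [sum_filter]
      simp only [ite_not]
    rw [h]
    refine sum_nbij' (insert i) (fun S => S.erase i) ?_ ?_ ?_ ?_ ?_ <;> simp +contextual
  have hb : ∀ i (e : ι → Bool), ∑ T, b i T * walsh T e =
      multilinDeriv a i fun j => 1 / 2 * boolSign (e j) := by
    intro i e
    rw [multilinDeriv, ← hre]
    refine sum_congr rfl fun T _ => ?_
    simp only [b]
    split_ifs with h
    · simp
    · rw [erase_insert h, prod_mul_distrib, prod_const, walsh]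
      ring
  have hbk : ∀ i S, b i S ≠ 0 → #S ≤ k - 1 := by
    intro i S h
    by_cases hi : i ∈ S
    · simp [b, hi] at h
    · have : a (insert i S) ≠ 0 := by
        intro h0
        simp [b, h0] at h
      have := hk _ this
      rw [card_insert_of_notMem hi] at this
      omega
  have hbs : ∀ i, √(∑ S with i ∈ S, a S ^ 2) ≤ 2 ^ (k - 1) * √(∑ T, b i T ^ 2) := by
    intro i
    refine Real.sqrt_le_iff.2 ⟨by positivity, ?_⟩
    rw [mul_pow, Real.sq_sqrt (sum_nonneg fun _ _ => sq_nonneg _), ← hre, mul_sum]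
    refine sum_le_sum fun T _ => ?_
    by_cases hT : b i T = 0
    · rw [hT]
      split_ifs with h
      · simp
      · have : a (insert i T) = 0 := by simpa [b, h] using hT
        simp [this]
    · have hc := hbk i T hT
      have h : i ∉ T := fun h => hT (by simp [b, h])
      simp only [b, h, if_false]
      rw [mul_pow, mul_left_comm, ← mul_pow, show k - 1 = (k - 1 - #T) + #T by omega, pow_add,
        mul_assoc, ← mul_pow]
      norm_num
      rw [← mul_pow, show (2 : ℝ) * (1 / 2) = 1 by norm_num, one_pow, mul_one, mul_pow]
      exact le_mul_of_one_le_right (sq_nonneg _) (one_le_pow₀ (one_le_pow₀ (by norm_num)))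
  have h1 : ∀ i, √(∑ S with i ∈ S, a S ^ 2) ≤
      6 ^ (k - 1) * 𝔼 e : ι → Bool, |multilinDeriv a i fun j => 1 / 2 * boolSign (e j)| := by
    intro i
    refine (hbs i).trans ?_
    have := sqrt_sum_sq_le_expect_abs (k - 1) (b i) (hbk i)
    simp only [hb] at this
    rw [show (6 : ℝ) = 2 * 3 by norm_num, mul_pow, mul_assoc]
    gcongr
  refine (sum_le_sum fun i _ => h1 i).trans ?_
  rw [← mul_sum, ← expect_sum_comm]
  rw [mul_comm _ ((6 : ℝ) ^ (k - 1)), mul_assoc]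
  gcongr
  refine expect_le univ_nonempty fun e _ => ?_
  refine sum_abs_multilinDeriv_le hk hM _ fun i => ?_
  rw [abs_mul, abs_boolSign]
  norm_num

end Boolean

/-! ### Product states and their energies. -/

/-- The tensor product of single-qubit operators. -/
def tensorOp {n : ℕ} (A : Fin n → Matrix (Fin 2) (Fin 2) ℂ) : QubitOp n :=
  Matrix.of fun x y => ∏ i, A i (x i) (y i)

theorem tensorOp_mul {n : ℕ} (A B : Fin n → Matrix (Fin 2) (Fin 2) ℂ) :
    tensorOp A * tensorOp B = tensorOp fun i => A i * B i := by
  ext x y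
  simp only [tensorOp, Matrix.mul_apply, Matrix.of_apply, ← prod_mul_distrib]
  exact (Fintype.prod_sum fun i b => A i (x i) b * B i b (y i)).symm

theorem trace_tensorOp {n : ℕ} (A : Fin n → Matrix (Fin 2) (Fin 2) ℂ) :
    (tensorOp A).trace = ∏ i, (A i).trace := by
  simp only [tensorOp, Matrix.trace, Matrix.diag_apply, Matrix.of_apply]
  exact (Fintype.prod_sum fun i b => A i b b).symm

theorem conjTranspose_tensorOp {n : ℕ} (A : Fin n → Matrix (Fin 2) (Fin 2) ℂ) :
    (tensorOp A).conjTranspose = tensorOp fun i => (A i).conjTranspose := by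
  ext x y
  simp [tensorOp, Matrix.conjTranspose_apply]

theorem Pauli.conjTranspose_toMatrix (p : Pauli) : p.toMatrix.conjTranspose = p.toMatrix := by
  ext a b
  cases p <;> fin_cases a <;> fin_cases b <;> simp [Pauli.toMatrix]

theorem im_pauliCoeff {n : ℕ} {H : QubitOp n} (hH : H.IsHermitian) (P : PauliString n) :
    (pauliCoeff H P).im = 0 := by
  have hP : (pauliOp P).conjTranspose = pauliOp P := by
    have := conjTranspose_tensorOp fun i => (P i).toMatrix
    simp only [Pauli.conjTranspose_toMatrix] at this
    exact this
  have h : star (pauliOp P * H).trace = (pauliOp P * H).trace := by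
    rw [← Matrix.trace_conjTranspose, Matrix.conjTranspose_mul, hH.eq, hP, Matrix.trace_mul_comm]
  have h2 : star (pauliCoeff H P) = pauliCoeff H P := by
    simp only [pauliCoeff, star_div₀, star_pow, h]
    simp
  exact Complex.conj_eq_iff_im.1 h2

/-- The trace is the sum of `⟨b, H b⟩` over the columns `b` of `B`. With `B Bᴴ` a state, this says
that energies are at most the spectral norm. -/
theorem norm_trace_conjTranspose_mul_mul_le {n : ℕ} (H B : QubitOp n) :
    ‖(B.conjTranspose * (H * B)).trace‖ ≤ opNorm H * ‖(B.conjTranspose * B).trace‖ := by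
  let b : (Fin n → Fin 2) → EuclideanSpace ℂ (Fin n → Fin 2) := fun y =>
    WithLp.toLp 2 fun x => B x y
  have h1 : ∀ y, (B.conjTranspose * (H * B)) y y =
      inner ℂ (b y) (Matrix.toEuclideanCLM (n := Fin n → Fin 2) (𝕜 := ℂ) H (b y)) := by
    intro y
    simp [b, Matrix.mul_apply, PiLp.inner_apply, Matrix.toEuclideanCLM_toLp, Matrix.mulVec,
      dotProduct, mul_comm]
  have h2 : (B.conjTranspose * B).trace = ((∑ y, ‖b y‖ ^ 2 : ℝ) : ℂ) := by
    simp [b, Matrix.trace, Matrix.mul_apply, EuclideanSpace.norm_sq_eq, Complex.conj_mul']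
  rw [h2, Complex.norm_real, Real.norm_of_nonneg (sum_nonneg fun _ _ => sq_nonneg _), mul_sum]
  simp only [Matrix.trace, Matrix.diag_apply, h1]
  refine (norm_sum_le _ _).trans (sum_le_sum fun y _ => ?_)
  refine (norm_inner_le_norm _ _).trans ?_
  rw [sq, mul_left_comm]
  gcongr
  exact ContinuousLinearMap.le_opNorm _ _

/-- Every Bloch vector in the cube of side `2 / √3` belongs to a state `B Bᴴ`. -/
theorem exists_blochFactor (v : Pauli → ℝ) (hv : ∀ p, |v p| ≤ (√3)⁻¹) :
    ∃ B : Matrix (Fin 2) (Fin 2) ℂ, ∀ p : Pauli,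
      (p.toMatrix * (B * B.conjTranspose)).trace = if p = Pauli.I then 1 else (v p : ℂ) := by
  have hsq : ∀ p, v p ^ 2 ≤ 1 / 3 := by
    intro p
    have := pow_le_pow_left₀ (abs_nonneg _) (hv p) 2
    rw [sq_abs, inv_pow, Real.sq_sqrt (by norm_num)] at this
    linarith
  obtain ⟨x, hx⟩ : ∃ x, x = v .X := ⟨_, rfl⟩
  obtain ⟨y, hy⟩ : ∃ y, y = v .Y := ⟨_, rfl⟩
  obtain ⟨z, hz⟩ : ∃ z, z = v .Z := ⟨_, rfl⟩
  have hx2 := hsq .X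
  have hy2 := hsq .Y
  have hz2 := hsq .Z
  rw [← hx] at hx2
  rw [← hy] at hy2
  rw [← hz] at hz2
  -- `B` is the lower triangular Cholesky factor of `(1 + xX + yY + zZ)/2`, with diagonal `s, u`.
  -- The pivot is positive since `z > -1`, and `u` is real since `x² + y² + z² ≤ 1`.
  have hz1 : 0 < 1 + z := by nlinarith
  obtain ⟨s, hs0, hs⟩ : ∃ s : ℝ, 0 < s ∧ s ^ 2 = (1 + z) / 2 :=
    ⟨√((1 + z) / 2), Real.sqrt_pos.2 (by positivity), Real.sq_sqrt (by positivity)⟩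
  obtain ⟨u, hu⟩ : ∃ u : ℝ, u ^ 2 = (1 - x ^ 2 - y ^ 2 - z ^ 2) / (2 * (1 + z)) :=
    ⟨√((1 - x ^ 2 - y ^ 2 - z ^ 2) / (2 * (1 + z))),
      Real.sq_sqrt (div_nonneg (by linarith) (by positivity))⟩
  have h11 : (x ^ 2 + y ^ 2) / (4 * s ^ 2) + u ^ 2 = (1 - z) / 2 := by
    rw [hu, hs]
    field_simp
    ring
  refine ⟨!![(s : ℂ), 0; ((x : ℂ) + y * Complex.I) / (2 * s), u], ?_⟩
  have hs0' : (s : ℂ) ≠ 0 := by exact_mod_cast hs0.ne'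
  have hB : !![(s : ℂ), 0; ((x : ℂ) + y * Complex.I) / (2 * s), u] *
      (!![(s : ℂ), 0; ((x : ℂ) + y * Complex.I) / (2 * s), u]).conjTranspose =
      !![(1 + z : ℂ) / 2, (x - y * Complex.I) / 2; (x + y * Complex.I) / 2, (1 - z) / 2] := by
    have hsC : (s : ℂ) ^ 2 = (1 + z) / 2 := by exact_mod_cast hs
    have h11C : ((x : ℂ) ^ 2 + y ^ 2) / (4 * s ^ 2) + u ^ 2 = (1 - z) / 2 := by exact_mod_cast h11
    ext a b
    fin_cases a <;> fin_cases b <;>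
      simp [Matrix.mul_apply, Fin.sum_univ_two, Matrix.conjTranspose_apply, map_ofNat]
    · rw [← hsC]; ring
    · field_simp
      ring
    · field_simp
    · rw [← h11C]
      field_simp
      linear_combination (-4 * (y : ℂ) ^ 2) * Complex.I_sq
  rw [hB]
  intro p
  cases p <;> simp [Pauli.toMatrix, Matrix.trace_fin_two, ← hx, ← hy, ← hz]
  · ring
  · ring
  · linear_combination (-(y : ℂ)) * Complex.I_sq
  · ring

/-- The left side is the absolute energy of `H` in the product of the states `B i (B i)ᴴ`, whose
trace is `1`. -/
theorem abs_sum_pauliCoeff_mul_prod_le {n : ℕ} {H : QubitOp n} (hH : H.IsHermitian)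
    (v : Fin n → Pauli → ℝ) (hv : ∀ i p, |v i p| ≤ (√3)⁻¹) :
    |∑ P, (pauliCoeff H P).re * ∏ i ∈ dom P, v i (P i)| ≤ opNorm H := by
  choose B hB using fun i => exists_blochFactor (v i) (hv i)
  have hcoeff : ∀ P, pauliCoeff H P = ((pauliCoeff H P).re : ℂ) := fun P =>
    Complex.ext rfl (by simpa using im_pauliCoeff hH P)
  have hP : ∀ P : PauliString n, (pauliOp P * (tensorOp B * (tensorOp B).conjTranspose)).trace =
      ((∏ i ∈ dom P, v i (P i) : ℝ) : ℂ) := by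
    intro P
    rw [conjTranspose_tensorOp, tensorOp_mul,
      show pauliOp P = tensorOp fun i => (P i).toMatrix from rfl, tensorOp_mul, trace_tensorOp]
    simp only [hB]
    rw [dom, prod_filter]
    push_cast
    refine prod_congr rfl fun i _ => ?_
    split_ifs <;> simp_all
  have h1 : (((tensorOp B).conjTranspose * tensorOp B).trace : ℂ) = 1 := by
    have h := hP fun _ => Pauli.I
    have hI : pauliOp (fun _ : Fin n => Pauli.I) = 1 := by
      ext x y
      have hI' : Pauli.I.toMatrix = 1 := Matrix.one_fin_two.symm
      simp only [pauliOp, Matrix.of_apply, hI', Matrix.one_apply]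
      rw [prod_ite_zero]
      simp [funext_iff]
    rw [hI, one_mul, Matrix.trace_mul_comm] at h
    rw [h]
    simp [dom]
  have h2 : ((tensorOp B).conjTranspose * (H * tensorOp B)).trace =
      ((∑ P, (pauliCoeff H P).re * ∏ i ∈ dom P, v i (P i) : ℝ) : ℂ) := by
    rw [Matrix.trace_mul_comm, Matrix.mul_assoc]
    nth_rw 1 [← sum_pauliCoeff_smul H]
    rw [Matrix.sum_mul, Matrix.trace_sum]
    push_cast
    refine sum_congr rfl fun P _ => ?_
    rw [Matrix.smul_mul, Matrix.trace_smul, hP, ← hcoeff, smul_eq_mul]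
    push_cast
    rfl
  have h := norm_trace_conjTranspose_mul_mul_le H (tensorOp B)
  rwa [h1, h2, Complex.norm_real, Real.norm_eq_abs, norm_one, mul_one] at h

/-! ### The energy polynomial of a local Hamiltonian. -/

/-- The set of pairs `(i, P i)` with `P i ≠ I`. -/
def labelledDom {n : ℕ} (P : PauliString n) : Finset (Fin n × Pauli) :=
  (dom P).image fun i => (i, P i)

theorem mem_labelledDom {n : ℕ} {P : PauliString n} {i : Fin n} {p : Pauli} :
    (i, p) ∈ labelledDom P ↔ P i = p ∧ p ≠ Pauli.I := by
  simp only [labelledDom, dom, mem_image, mem_filter, mem_univ, true_and, Prod.mk.injEq]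
  constructor
  · rintro ⟨j, hj, rfl, rfl⟩
    exact ⟨rfl, hj⟩
  · rintro ⟨rfl, h⟩
    exact ⟨i, h, rfl, rfl⟩

theorem labelledDom_injective {n : ℕ} : Function.Injective (labelledDom (n := n)) := by
  intro P Q h
  funext i
  have h1 := fun p => (mem_labelledDom (P := P) (i := i) (p := p)).symm.trans
    (h ▸ mem_labelledDom (P := Q) (i := i) (p := p))
  by_cases hP : P i = Pauli.I
  · by_contra hne
    exact hne ((h1 (Q i)).2 ⟨rfl, fun h => hne (hP.trans h.symm)⟩).1
  · exact ((h1 (P i)).1 ⟨rfl, hP⟩).1.symm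

theorem injective_pair {n : ℕ} (P : PauliString n) :
    Function.Injective fun i : Fin n => (i, P i) := fun _ _ h => (Prod.mk.inj h).1

/-- The coefficients of the multilinear polynomial computing the energies of `H` in product states
with Bloch vectors in the cube of side `2 / √3`. -/
noncomputable def energyCoeff {n : ℕ} (H : QubitOp n) : Finset (Fin n × Pauli) → ℝ :=
  Function.extend labelledDom (fun P => (pauliCoeff H P).re * (√3)⁻¹ ^ #(dom P)) 0

theorem energyCoeff_labelledDom {n : ℕ} (H : QubitOp n) (P : PauliString n) :
    energyCoeff H (labelledDom P) = (pauliCoeff H P).re * (√3)⁻¹ ^ #(dom P) :=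
  labelledDom_injective.extend_apply _ _ _

theorem sum_energyCoeff {n : ℕ} (H : QubitOp n) (f : Finset (Fin n × Pauli) → ℝ → ℝ)
    (hf : ∀ S, f S 0 = 0) :
    ∑ S, f S (energyCoeff H S) =
      ∑ P, f (labelledDom P) ((pauliCoeff H P).re * (√3)⁻¹ ^ #(dom P)) := by
  symm
  refine sum_of_injOn labelledDom labelledDom_injective.injOn (by simp) ?_ ?_
  · intro S _ hS
    have : energyCoeff H S = 0 := Function.extend_apply' _ _ _ (by simpa using hS)
    rw [this, hf]
  · intro P _
    rw [energyCoeff_labelledDom]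

theorem abs_multilin_energyCoeff_le {n : ℕ} {H : QubitOp n} (hH : H.IsHermitian)
    (x : Fin n × Pauli → ℝ) (hx : ∀ i, |x i| ≤ 1) : |multilin (energyCoeff H) x| ≤ opNorm H := by
  have h := abs_sum_pauliCoeff_mul_prod_le hH (fun i p => x (i, p) * (√3)⁻¹) fun i p => by
    rw [abs_mul, abs_of_nonneg (a := (√3)⁻¹) (by positivity)]
    exact mul_le_of_le_one_left (by positivity) (hx _)
  rw [multilin, sum_energyCoeff H (fun S t => t * ∏ i ∈ S, x i) (by simp)]
  refine le_of_eq_of_le (congrArg _ (sum_congr rfl fun P _ => ?_)) h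
  rw [labelledDom, prod_image (injective_pair P).injOn, prod_mul_distrib, prod_const]
  ring

theorem card_le_of_energyCoeff_ne_zero {n k : ℕ} {H : QubitOp n} (hH : IsLocalHamiltonian H k)
    (S : Finset (Fin n × Pauli)) (hS : energyCoeff H S ≠ 0) : #S ≤ k := by
  by_cases h : ∃ P, labelledDom P = S
  · obtain ⟨P, rfl⟩ := h
    rw [energyCoeff_labelledDom] at hS
    rw [labelledDom, card_image_of_injective _ (injective_pair P)]
    exact hH.2 P fun h0 => hS (by simp [h0])
  · exact absurd (Function.extend_apply' _ _ _ h) hS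

theorem norm_pauliCoeff {n : ℕ} {H : QubitOp n} (hH : H.IsHermitian) (P : PauliString n) :
    ‖pauliCoeff H P‖ = |(pauliCoeff H P).re| := by
  rw [← Real.norm_eq_abs, ← Complex.norm_real]
  congr 1
  exact Complex.ext rfl (by simpa using im_pauliCoeff hH P)

theorem norm_pauliCoeff_sq_le {n k : ℕ} {H : QubitOp n} (hH : IsLocalHamiltonian H k)
    (P : PauliString n) :
    ‖pauliCoeff H P‖ ^ 2 ≤ 3 ^ k * ((pauliCoeff H P).re * (√3)⁻¹ ^ #(dom P)) ^ 2 := by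
  rw [norm_pauliCoeff hH.1, sq_abs]
  by_cases h : pauliCoeff H P = 0
  · simp [h]
  · have hk := hH.2 P h
    rw [mul_pow, ← pow_mul, mul_comm _ 2, pow_mul, inv_pow, Real.sq_sqrt (by norm_num),
      mul_left_comm]
    refine le_mul_of_one_le_right (sq_nonneg _) ?_
    rw [inv_pow, ← div_eq_mul_inv, one_le_div (by positivity)]
    exact pow_le_pow_right₀ (by norm_num) hk

theorem sum_norm_pauliCoeff_sq_le {n k : ℕ} {H : QubitOp n} (hH : IsLocalHamiltonian H k) :
    ∑ P, ‖pauliCoeff H P‖ ^ 2 ≤ 3 ^ k * opNorm H ^ 2 := by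
  have h := sum_sq_le_of_abs_multilin_le (abs_multilin_energyCoeff_le hH.1)
  rw [sum_energyCoeff H (fun _ t => t ^ 2) (by simp)] at h
  refine (sum_le_sum fun P _ => norm_pauliCoeff_sq_le hH P).trans ?_
  rw [← mul_sum]
  gcongr

/-- The identity coefficient is the energy of the maximally mixed state, with all Bloch vectors
zero. -/
theorem norm_pauliCoeff_one_le {n : ℕ} {H : QubitOp n} (hH : H.IsHermitian) :
    ‖pauliCoeff H fun _ => Pauli.I‖ ≤ opNorm H := by
  have h := abs_sum_pauliCoeff_mul_prod_le hH (fun _ _ => 0) (by simp)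
  rw [sum_eq_single (fun _ => Pauli.I)] at h
  · simpa [norm_pauliCoeff hH, dom] using h
  · intro P _ hP
    obtain ⟨i, hi⟩ := Function.ne_iff.1 hP
    rw [prod_eq_zero (i := i) (by simpa [dom] using hi) rfl, mul_zero]
  · simp

/-- The total influence-type sum of a local Hamiltonian is bounded by its spectral norm. -/
theorem sum_sqrt_sum_norm_pauliCoeff_sq_le {n k : ℕ} {H : QubitOp n}
    (hH : IsLocalHamiltonian H k) :
    ∑ i, √(∑ P with i ∈ dom P, ‖pauliCoeff H P‖ ^ 2) ≤
      4 * k ^ 2 * 6 ^ (k - 1) * √3 ^ k * opNorm H := by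
  have h := sum_sqrt_le_of_abs_multilin_le (card_le_of_energyCoeff_ne_zero hH)
    (abs_multilin_energyCoeff_le hH.1)
  have hi : ∀ i p, ∑ S with (i, p) ∈ S, energyCoeff H S ^ 2 =
      ∑ P with (i, p) ∈ labelledDom P, ((pauliCoeff H P).re * (√3)⁻¹ ^ #(dom P)) ^ 2 := by
    intro i p
    rw [sum_filter, sum_filter,
      sum_energyCoeff H (fun S t => if (i, p) ∈ S then t ^ 2 else 0) (by simp)]
  rw [Fintype.sum_prod_type] at h
  simp only [hi] at h
  have h1 : ∀ i, √(∑ P with i ∈ dom P, ‖pauliCoeff H P‖ ^ 2) ≤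
      √3 ^ k * ∑ p, √(∑ P with (i, p) ∈ labelledDom P,
        ((pauliCoeff H P).re * (√3)⁻¹ ^ #(dom P)) ^ 2) := by
    intro i
    set g : Pauli → ℝ := fun p => ∑ P with (i, p) ∈ labelledDom P,
        ((pauliCoeff H P).re * (√3)⁻¹ ^ #(dom P)) ^ 2 with hg
    have hg0 : ∀ p, 0 ≤ g p := fun p => sum_nonneg fun _ _ => sq_nonneg _
    have h2 : ∑ P with i ∈ dom P, ‖pauliCoeff H P‖ ^ 2 ≤ 3 ^ k * ∑ p, g p := by
      -- A string acting on `i` is counted for exactly one label, its own letter at `i`.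
      have h3 : ∑ p, g p = ∑ P with i ∈ dom P,
          ((pauliCoeff H P).re * (√3)⁻¹ ^ #(dom P)) ^ 2 := by
        simp only [hg, sum_filter]
        rw [sum_comm]
        refine sum_congr rfl fun P _ => ?_
        simp only [mem_labelledDom, dom, mem_filter, mem_univ, true_and]
        rw [sum_eq_single (P i)]
        · simp
        · intro p _ hp
          simp [hp.symm]
        · simp
      rw [h3, mul_sum]
      exact sum_le_sum fun P _ => norm_pauliCoeff_sq_le hH P
    refine Real.sqrt_le_iff.2 ⟨by positivity, h2.trans ?_⟩
    rw [mul_pow, ← pow_mul, mul_comm k, pow_mul, Real.sq_sqrt (by norm_num)]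
    gcongr
    calc ∑ p, g p = ∑ p, √(g p) ^ 2 := sum_congr rfl fun p _ => (Real.sq_sqrt (hg0 p)).symm
      _ ≤ (∑ p, √(g p)) ^ 2 := sum_sq_le_sq_sum_of_nonneg fun _ _ => Real.sqrt_nonneg _
  refine (sum_le_sum fun i _ => h1 i).trans ?_
  rw [← mul_sum, mul_comm _ (√3 ^ k), mul_assoc]
  gcongr

/-! ### From the mixed norm to the Pauli norm, using expansion. -/

/-- A mixed-norm inequality of Blei type: the `ℓ^{2d/(d+1)}` norm of a family indexed by `κ` is
controlled by the `ℓ^1(ℓ^2)` norm along the coordinates of a map from `κ` to `d`-tuples whose fibres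
have at most `c` elements. -/
theorem sum_rpow_le_of_card_fiber_le {κ V : Type*} [Fintype κ] [Fintype V] [DecidableEq V]
    {d : ℕ} (hd : 1 ≤ d) {c : ℝ} (hc : 0 < c) (a : κ → ℝ) (ha : ∀ P, 0 ≤ a P)
    (D : κ → Finset V) (s : Finset κ) (τ : κ → Fin d → V) (hτ : ∀ P ∈ s, ∀ m, τ P m ∈ D P)
    (hfib : ∀ t, (#{P ∈ s | τ P = t} : ℝ) ≤ c) :
    ∑ P ∈ s, a P ^ expansionExponent d ≤
      c ^ (1 / ((d : ℝ) + 1)) * (∑ i, √(∑ P with i ∈ D P, a P ^ 2)) ^ expansionExponent d := by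
  have hpow : ∀ x : ℝ, 0 ≤ x → x ^ expansionExponent d = (x ^ (2 * d)) ^ (1 / ((d : ℝ) + 1)) := by
    intro x hx
    rw [← Real.rpow_natCast, ← Real.rpow_mul hx, expansionExponent]
    congr 1
    push_cast
    ring
  set w : V → ℝ := fun i => √(∑ P with i ∈ D P, a P ^ 2) with hw
  set A := ∑ i, w i with hA
  have hw0 : ∀ i, 0 ≤ w i := fun i => Real.sqrt_nonneg _
  have hA0 : 0 ≤ A := sum_nonneg fun i _ => hw0 i
  have haw : ∀ P i, i ∈ D P → a P ≤ w i := fun P i hi =>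
    Real.le_sqrt_of_sq_le (single_le_sum (f := fun P => a P ^ 2) (fun _ _ => sq_nonneg _)
      (mem_filter.2 ⟨mem_univ P, hi⟩))
  rcases hA0.eq_or_lt with h0 | hApos
  · have hz : ∀ P ∈ s, a P = 0 := by
      intro P hP
      have h1 := haw P _ (hτ P hP ⟨0, hd⟩)
      have h2 : w (τ P ⟨0, hd⟩) ≤ A := single_le_sum (fun i _ => hw0 i) (mem_univ _)
      exact le_antisymm (by linarith) (ha P)
    have hr : expansionExponent d ≠ 0 := by
      have : (0 : ℝ) < d := by exact_mod_cast hd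
      unfold expansionExponent
      positivity
    rw [sum_eq_zero fun P hP => by rw [hz P hP, Real.zero_rpow hr]]
    positivity
  have hq : (0 : ℝ) < (d : ℝ) + 1 := by positivity
  -- AM-GM with `d + 1` equal weights; the factors `w (τ P m)` cancel in the product. Summed over
  -- `P`, each of the `d + 1` terms on the right is at most `1`.
  have hterm : ∀ P ∈ s, (a P ^ (2 * d) / (c * A ^ (2 * d))) ^ (1 / ((d : ℝ) + 1)) ≤
      1 / ((d : ℝ) + 1) * ((∏ m, w (τ P m)) / (c * A ^ d) +
        ∑ m, a P ^ 2 / w (τ P m) / A) := by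
    intro P hP
    have hR : 0 ≤ 1 / ((d : ℝ) + 1) * ((∏ m, w (τ P m)) / (c * A ^ d) +
        ∑ m, a P ^ 2 / w (τ P m) / A) := by
      have := prod_nonneg fun m (_ : m ∈ (univ : Finset (Fin d))) => hw0 (τ P m)
      have := sum_nonneg fun m (_ : m ∈ (univ : Finset (Fin d))) =>
        div_nonneg (div_nonneg (sq_nonneg (a P)) (hw0 (τ P m))) hA0
      positivity
    -- If `a P = 0` some weight `w (τ P m)` may vanish, and the cancellation would fail.
    rcases (ha P).eq_or_lt with h | h
    · rw [← h, zero_pow (by omega), zero_div, Real.zero_rpow (by positivity)]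
      rwa [← h] at hR
    let z : Option (Fin d) → ℝ := fun o =>
      o.elim ((∏ m, w (τ P m)) / (c * A ^ d)) fun m => a P ^ 2 / w (τ P m) / A
    have hwpos : ∀ m, 0 < w (τ P m) := fun m => h.trans_le (haw P _ (hτ P hP m))
    have hz : ∀ o, 0 ≤ z o := by
      rintro (_ | m)
      · exact div_nonneg (prod_nonneg fun m _ => hw0 _) (by positivity)
      · exact div_nonneg (div_nonneg (sq_nonneg _) (hw0 _)) hA0
    have hg := Real.geom_mean_le_arith_mean_weighted univ
      (fun _ : Option (Fin d) => 1 / ((d : ℝ) + 1)) z (fun _ _ => by positivity)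
      (by simp [mul_inv_cancel₀ hq.ne']) fun o _ => hz o
    rw [← mul_sum, Real.finsetProd_rpow _ _ fun o _ => hz o, Fintype.sum_option,
      Fintype.prod_option] at hg
    refine le_of_eq_of_le ?_ hg
    congr 1
    have hprod : ∏ m, w (τ P m) ≠ 0 := prod_ne_zero_iff.2 fun m _ => (hwpos m).ne'
    simp only [z, Option.elim_none, Option.elim_some, prod_div_distrib, prod_const, card_univ,
      Fintype.card_fin]
    field_simp
    ring
  have h1 : ∀ m, ∑ P ∈ s, a P ^ 2 / w (τ P m) ≤ A := by
    intro m
    calc ∑ P ∈ s, a P ^ 2 / w (τ P m) ≤ ∑ P ∈ s, ∑ i ∈ D P, a P ^ 2 / w i :=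
          sum_le_sum fun P hP => single_le_sum (f := fun i => a P ^ 2 / w i)
            (fun i _ => div_nonneg (sq_nonneg _) (hw0 i)) (hτ P hP m)
      _ ≤ ∑ P, ∑ i ∈ D P, a P ^ 2 / w i :=
          sum_le_sum_of_subset_of_nonneg (subset_univ _) fun P _ _ =>
            sum_nonneg fun i _ => div_nonneg (sq_nonneg _) (hw0 i)
      _ = ∑ i, ∑ P with i ∈ D P, a P ^ 2 / w i := sum_comm' (by simp)
      _ = A := sum_congr rfl fun i _ => by
          rw [← sum_div]
          exact Real.div_sqrt
  have h2 : ∑ P ∈ s, ∏ m, w (τ P m) ≤ c * A ^ d := by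
    have hAd : A ^ d = ∑ t : Fin d → V, ∏ m, w (t m) := by
      rw [← Fintype.prod_sum fun (_ : Fin d) i => w i, prod_const, card_univ, Fintype.card_fin]
    rw [← sum_fiberwise s τ, hAd, mul_sum]
    refine sum_le_sum fun t _ => ?_
    rw [sum_congr rfl (g := fun _ => ∏ m, w (t m)) fun P hP => by rw [(mem_filter.1 hP).2],
      sum_const, nsmul_eq_mul]
    exact mul_le_mul_of_nonneg_right (hfib t) (prod_nonneg fun m _ => hw0 _)
  have h3 := sum_le_sum hterm
  have h4 : ∑ P ∈ s, 1 / ((d : ℝ) + 1) * ((∏ m, w (τ P m)) / (c * A ^ d) +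
        ∑ m, a P ^ 2 / w (τ P m) / A) ≤ 1 := by
    rw [← mul_sum, sum_add_distrib, ← sum_div, sum_comm, one_div, inv_mul_le_iff₀ hq, mul_one]
    have h5 : (∑ P ∈ s, ∏ m, w (τ P m)) / (c * A ^ d) ≤ 1 := (div_le_one (by positivity)).2 h2
    have h6 : ∑ m, ∑ P ∈ s, a P ^ 2 / w (τ P m) / A ≤ ∑ m : Fin d, (1 : ℝ) := by
      refine sum_le_sum fun m _ => ?_
      rw [← sum_div]
      exact (div_le_one hApos).2 (h1 m)
    simp only [sum_const, card_univ, Fintype.card_fin, nsmul_eq_mul, mul_one] at h6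
    linarith
  have h7 : ∑ P ∈ s, (a P ^ (2 * d) / (c * A ^ (2 * d))) ^ (1 / ((d : ℝ) + 1)) =
      (∑ P ∈ s, a P ^ expansionExponent d) / (c ^ (1 / ((d : ℝ) + 1)) * A ^ expansionExponent d) := by
    rw [sum_div]
    refine sum_congr rfl fun P _ => ?_
    rw [hpow _ (ha P), hpow _ hA0, Real.div_rpow (pow_nonneg (ha P) _) (by positivity),
      Real.mul_rpow hc.le (by positivity)]
  rw [h7] at h3
  exact (div_le_one (by positivity)).1 (h3.trans h4)

/-- The tag of a string: `d` distinct points of its domain, or an enumeration with repetitions of a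
domain with fewer than `d` points. The two alternatives match the two inclusions in `HasExpansion`.
-/
theorem exists_tuple {V : Type*} [DecidableEq V] {d : ℕ} (hd : 1 ≤ d) (T : Finset V)
    (hT : T.Nonempty) :
    ∃ t : Fin d → V, (∀ m, t m ∈ T) ∧ (#(univ.image t) = d ∨ univ.image t = T) := by
  obtain ⟨S, hST, hS⟩ := exists_subset_card_eq (s := T) (n := min d #T) (min_le_right _ _)
  have hpos : 0 < #S := by
    rw [hS]
    exact lt_min hd hT.card_pos
  have : Nonempty S := (card_pos.1 hpos).to_subtype
  obtain ⟨f⟩ : Nonempty (S ↪ Fin d) := Function.Embedding.nonempty_of_card_le (by simp [hS])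
  have hf := Function.invFun_surjective f.injective
  have him : univ.image (fun m => ((Function.invFun f m : S) : V)) = S := by
    ext x
    simp only [mem_image, mem_univ, true_and]
    constructor
    · rintro ⟨m, rfl⟩
      exact (Function.invFun f m).2
    · intro hx
      obtain ⟨m, hm⟩ := hf ⟨x, hx⟩
      exact ⟨m, by rw [hm]⟩
  refine ⟨fun m => ((Function.invFun f m : S) : V), fun m => hST (Function.invFun f m).2, ?_⟩
  rw [him]
  rcases le_total d #T with h | h
  · left
    omega
  · right
    exact eq_of_subset_of_card_le hST (by omega)

theorem expansionExponent_mem {d : ℕ} (hd : 1 ≤ d) :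
    1 ≤ expansionExponent d ∧ expansionExponent d < 2 := by
  have h : (1 : ℝ) ≤ d := by exact_mod_cast hd
  unfold expansionExponent
  rw [le_div_iff₀ (by positivity), div_lt_iff₀ (by positivity)]
  constructor <;> linarith

theorem pauliNorm_le_of_le {n k d : ℕ} {c : ℝ} (hd : 1 ≤ d) (hc : 1 ≤ c) (hdn : d ≤ n)
    {H : QubitOp n} (hH : IsLocalHamiltonian H k) (hexp : HasExpansion H c d) :
    pauliNorm H (expansionExponent d) ≤ c ^ (1 / (2 * (d : ℝ))) *
      (opNorm H + ∑ i, √(∑ P with i ∈ dom P, ‖pauliCoeff H P‖ ^ 2)) := by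
  have hr := (expansionExponent_mem hd).1
  set r := expansionExponent d with hrdef
  set A := ∑ i, √(∑ P with i ∈ dom P, ‖pauliCoeff H P‖ ^ 2)
  have hA : 0 ≤ A := sum_nonneg fun _ _ => Real.sqrt_nonneg _
  have hM : 0 ≤ opNorm H := norm_nonneg _
  have hd0 : (0 : ℝ) < d := by exact_mod_cast hd
  set J : PauliString n := fun _ => Pauli.I
  have hne : ∀ P : PauliString n, P ≠ J → (dom P).Nonempty := by
    intro P hP
    obtain ⟨i, hi⟩ := Function.ne_iff.1 hP
    exact ⟨i, by simpa [dom, J] using hi⟩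
  have hτ : ∀ P : PauliString n, ∃ t : Fin d → Fin n, P ≠ J →
      (∀ m, t m ∈ dom P) ∧ (#(univ.image t) = d ∨ univ.image t = dom P) := by
    intro P
    by_cases hP : P = J
    · exact ⟨fun _ => ⟨0, by omega⟩, fun h => absurd hP h⟩
    · obtain ⟨t, ht⟩ := exists_tuple hd (dom P) (hne P hP)
      exact ⟨t, fun _ => ht⟩
  choose τ hτ using hτ
  have hblei := sum_rpow_le_of_card_fiber_le hd (c := c) (by linarith)
    (fun P => ‖pauliCoeff H P‖) (fun P => norm_nonneg _) dom
    (univ.filter fun P => P ≠ J ∧ pauliCoeff H P ≠ 0) τ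
    (fun P hP => (hτ P (mem_filter.1 hP).2.1).1) (by
      intro t
      -- `S` depends on the tag `t` alone, so one instance of the expansion bound covers the whole
      -- fibre. Enlarging the image to `d` points needs `d ≤ n`.
      obtain ⟨S, htS, hS⟩ := exists_superset_card_eq (s := univ.image t) (n := d)
        (card_image_le.trans (by simp)) (by simpa using hdn)
      refine le_trans ?_ (hexp S hS)
      refine Nat.cast_le.2 (card_le_card fun P hP => ?_)
      simp only [mem_filter, mem_univ, true_and] at hP ⊢
      obtain ⟨⟨hPJ, hP0⟩, rfl⟩ := hP
      refine ⟨hP0, ?_⟩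
      rcases (hτ P hPJ).2 with h | h
      · left
        rw [← eq_of_subset_of_card_le htS (by omega)]
        intro i hi
        obtain ⟨m, _, rfl⟩ := mem_image.1 hi
        exact (hτ P hPJ).1 m
      · right
        rwa [← h])
  rw [← hrdef] at hblei
  have hc1 : 1 ≤ c ^ (1 / ((d : ℝ) + 1)) := Real.one_le_rpow hc (by positivity)
  have hsum : ∑ P, ‖pauliCoeff H P‖ ^ r ≤ c ^ (1 / ((d : ℝ) + 1)) * (opNorm H + A) ^ r := by
    have h1 : ∑ P, ‖pauliCoeff H P‖ ^ r = ‖pauliCoeff H J‖ ^ r +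
        ∑ P with P ≠ J ∧ pauliCoeff H P ≠ 0, ‖pauliCoeff H P‖ ^ r := by
      rw [← add_sum_erase _ _ (mem_univ J)]
      congr 1
      symm
      refine sum_subset (fun P hP => ?_) fun P hP hP' => ?_
      · simp only [mem_filter, mem_univ, true_and] at hP
        simp [hP.1]
      · have hPJ := (mem_erase.1 hP).1
        have : pauliCoeff H P = 0 := by
          by_contra h
          exact hP' (by simp [hPJ, h])
        rw [this, norm_zero, Real.zero_rpow (by linarith)]
    rw [h1]
    have h2 : ‖pauliCoeff H J‖ ^ r ≤ opNorm H ^ r :=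
      Real.rpow_le_rpow (norm_nonneg _) (norm_pauliCoeff_one_le hH.1) (by linarith)
    -- Superadditivity of `x ↦ x^r` absorbs the identity string, which has no tag.
    have h3 := Real.add_rpow_le_rpow_add hM hA hr
    have h4 : 0 ≤ opNorm H ^ r := Real.rpow_nonneg hM _
    nlinarith
  unfold pauliNorm
  refine (Real.rpow_le_rpow (sum_nonneg fun _ _ => Real.rpow_nonneg (norm_nonneg _) _) hsum
    (by positivity)).trans (le_of_eq ?_)
  rw [Real.mul_rpow (by positivity) (by positivity), ← Real.rpow_mul (by linarith),
    ← Real.rpow_mul (by positivity), mul_one_div_cancel (by linarith), Real.rpow_one]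
  congr 2
  rw [hrdef, expansionExponent]
  field_simp

/-- Hölder between `ℓ^r` and `ℓ²` over `4^n` strings. As `2/r - 1 = 1/d`, the squared norm loses
only `4^(n/d) ≤ 4`. -/
theorem pauliNorm_le_of_lt {n k d : ℕ} (hd : 1 ≤ d) (hnd : n < d)
    {H : QubitOp n} (hH : IsLocalHamiltonian H k) :
    pauliNorm H (expansionExponent d) ≤ 2 * √3 ^ k * opNorm H := by
  obtain ⟨hr, hr2⟩ := expansionExponent_mem hd
  set r := expansionExponent d with hrdef
  have hM : 0 ≤ opNorm H := norm_nonneg _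
  have hd0 : (0 : ℝ) < d := by exact_mod_cast hd
  have hr0 : 0 < r := by linarith
  have h := Real.rpow_sum_le_const_mul_sum_rpow univ
    (fun P : PauliString n => ‖pauliCoeff H P‖ ^ r) (p := 2 / r) ((one_le_div hr0).2 hr2.le)
  simp only [abs_of_nonneg (Real.rpow_nonneg (norm_nonneg _) r), ← Real.rpow_mul (norm_nonneg _),
    mul_div_cancel₀ (2 : ℝ) hr0.ne', Real.rpow_two] at h
  have hcard : ((#(univ : Finset (PauliString n)) : ℕ) : ℝ) ^ (2 / r - 1) ≤ 4 := by
    have h1 : #(univ : Finset (PauliString n)) = 4 ^ n := by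
      rw [card_univ, Fintype.card_fun, Fintype.card_fin]
      rfl
    have h2 : 2 / r - 1 = (d : ℝ)⁻¹ := by
      rw [hrdef, expansionExponent]
      field_simp
      ring
    rw [h1, h2]
    calc (((4 ^ n : ℕ) : ℝ)) ^ (d : ℝ)⁻¹ ≤ ((4 : ℝ) ^ d) ^ (d : ℝ)⁻¹ := by
          refine Real.rpow_le_rpow (by positivity) ?_ (by positivity)
          push_cast
          exact pow_le_pow_right₀ (by norm_num) hnd.le
      _ = 4 := Real.pow_rpow_inv_natCast (by norm_num) (by omega)
  have hS : 0 ≤ ∑ P, ‖pauliCoeff H P‖ ^ r :=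
    sum_nonneg fun _ _ => Real.rpow_nonneg (norm_nonneg _) _
  have h5 : pauliNorm H r ^ 2 ≤ 4 * (3 ^ k * opNorm H ^ 2) := by
    rw [pauliNorm, ← Real.rpow_two, ← Real.rpow_mul hS, one_div_mul_eq_div]
    exact h.trans (mul_le_mul hcard (sum_norm_pauliCoeff_sq_le hH)
      (sum_nonneg fun _ _ => sq_nonneg _) (by norm_num))
  refine le_of_sq_le_sq (h5.trans (le_of_eq ?_)) (by positivity)
  rw [mul_pow, mul_pow, ← pow_mul, mul_comm k, pow_mul, Real.sq_sqrt (by norm_num)]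
  ring

/-! ### Comparison of constants. -/

theorem factorial_mul_pow_le {k : ℕ} (hk : 1 ≤ k) :
    50 * 36 ^ (k - 1) * k.factorial ≤ 9 * (11 ^ k * k ^ (2 * k)) := by
  have key : 50 * 36 ^ (k - 1) ≤ 9 * (11 ^ k * k ^ k) := by
    rcases hk.lt_or_eq with h | rfl
    · rcases (Nat.succ_le_of_lt h).lt_or_eq with h | rfl
      -- The step from `k` to `k + 1` needs `36 ≤ 11 (k + 1)`, hence the start at `3`.
      · induction k, Nat.succ_le_of_lt h using Nat.le_induction with
        | base => norm_num
        | succ k hk3 ih =>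
          have hk3' : 3 ≤ k := hk3
          have ih' := ih (by omega) (by omega) (by omega)
          have h1 : k ^ k ≤ (k + 1) ^ k := Nat.pow_le_pow_left (by omega) k
          calc 50 * 36 ^ (k + 1 - 1) = 36 * (50 * 36 ^ (k - 1)) := by
                obtain ⟨m, rfl⟩ : ∃ m, k = m + 1 := ⟨k - 1, by omega⟩
                simp only [Nat.add_sub_cancel]
                ring
            _ ≤ (11 * (k + 1)) * (9 * (11 ^ k * k ^ k)) := Nat.mul_le_mul (by omega) ih'
            _ ≤ (11 * (k + 1)) * (9 * (11 ^ k * (k + 1) ^ k)) := by gcongr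
            _ = 9 * (11 ^ (k + 1) * (k + 1) ^ (k + 1)) := by ring
      · norm_num
    · norm_num
  calc 50 * 36 ^ (k - 1) * k.factorial ≤ 9 * (11 ^ k * k ^ k) * k ^ k :=
        Nat.mul_le_mul key (Nat.factorial_le_pow k)
    _ = 9 * (11 ^ k * k ^ (2 * k)) := by ring

/-- Since `√6 + 2√3 = √3 (2 + √2)`, the powers of `√3` cancel; `p ≥ 1/2` provides the factor `k²`.
Squaring what remains and using `(2 + √2)² ≥ 11` leaves `factorial_mul_pow_le`. -/
theorem const_le {k : ℕ} (hk : 1 ≤ k) {p : ℝ} (hp : 1 / 2 ≤ p) :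
    √(2 * (k.factorial : ℝ)) * (1 + 4 * k ^ 2 * 6 ^ (k - 1) * √3 ^ k) ≤
      3 * ((k : ℝ) ^ ((k : ℝ) + 3 / 2 + p) * (√6 + 2 * √3) ^ k) := by
  have hk1 : (1 : ℝ) ≤ k := by exact_mod_cast hk
  have h3 : 1 ≤ √3 := Real.one_le_sqrt.2 (by norm_num)
  have hpow : (k : ℝ) ^ (k + 2) ≤ (k : ℝ) ^ ((k : ℝ) + 3 / 2 + p) := by
    rw [← Real.rpow_natCast]
    refine Real.rpow_le_rpow_of_exponent_le hk1 ?_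
    push_cast
    linarith
  have hb : √6 + 2 * √3 = √3 * (2 + √2) := by
    rw [show (6 : ℝ) = 3 * 2 by norm_num, Real.sqrt_mul (by norm_num)]
    ring
  have h1 : (1 : ℝ) ≤ k ^ 2 * 6 ^ (k - 1) * √3 ^ k :=
    one_le_mul_of_one_le_of_one_le (one_le_mul_of_one_le_of_one_le (one_le_pow₀ hk1)
      (one_le_pow₀ (by norm_num))) (one_le_pow₀ h3)
  have h2 : (11 : ℝ) ≤ (2 + √2) ^ 2 := by
    have h : (5 / 4 : ℝ) ≤ √2 := Real.le_sqrt_of_sq_le (by norm_num)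
    nlinarith [Real.sq_sqrt (show (0 : ℝ) ≤ 2 by norm_num)]
  have hmain : 5 * √(2 * (k.factorial : ℝ)) * 6 ^ (k - 1) ≤ 3 * (k : ℝ) ^ k * (2 + √2) ^ k := by
    refine le_of_sq_le_sq ?_ (by positivity)
    have h := factorial_mul_pow_le hk
    have h' : (50 : ℝ) * 36 ^ (k - 1) * k.factorial ≤ 9 * (11 ^ k * k ^ (2 * k)) := by
      exact_mod_cast h
    calc (5 * √(2 * (k.factorial : ℝ)) * 6 ^ (k - 1)) ^ 2
        = 50 * 36 ^ (k - 1) * k.factorial := by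
          rw [mul_pow, mul_pow, Real.sq_sqrt (by positivity), ← pow_mul, mul_comm _ 2, pow_mul]
          norm_num
          ring
      _ ≤ 9 * (11 ^ k * k ^ (2 * k)) := h'
      _ ≤ 9 * (((2 + √2) ^ 2) ^ k * k ^ (2 * k)) := by gcongr
      _ = (3 * (k : ℝ) ^ k * (2 + √2) ^ k) ^ 2 := by
          rw [mul_pow, mul_pow, ← pow_mul, ← pow_mul, ← pow_mul, mul_comm k 2]
          ring
  calc √(2 * (k.factorial : ℝ)) * (1 + 4 * k ^ 2 * 6 ^ (k - 1) * √3 ^ k)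
      ≤ √(2 * (k.factorial : ℝ)) * (5 * (k ^ 2 * 6 ^ (k - 1) * √3 ^ k)) := by
        gcongr
        linarith
    _ = (5 * √(2 * (k.factorial : ℝ)) * 6 ^ (k - 1)) * (k ^ 2 * √3 ^ k) := by ring
    _ ≤ (3 * (k : ℝ) ^ k * (2 + √2) ^ k) * (k ^ 2 * √3 ^ k) := by gcongr
    _ = 3 * ((k : ℝ) ^ (k + 2) * (√6 + 2 * √3) ^ k) := by
        rw [hb, mul_pow]
        ring
    _ ≤ 3 * ((k : ℝ) ^ ((k : ℝ) + 3 / 2 + p) * (√6 + 2 * √3) ^ k) := by gcongr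

end PauliNorm

theorem mainTheorem7 (n k d : ℕ) (c : ℝ) (hk : 1 ≤ k) (hd : 1 ≤ d) (hc : 1 ≤ c)
    (H : PauliNorm.QubitOp n) (hH : PauliNorm.IsLocalHamiltonian H k)
    (hexp : PauliNorm.HasExpansion H c d) :
    (1 ≤ PauliNorm.expansionExponent d ∧ PauliNorm.expansionExponent d < 2) ∧
    1 / 3 * PauliNorm.expansionConst c d k *
        PauliNorm.pauliNorm H (PauliNorm.expansionExponent d) ≤
      PauliNorm.opNorm H := by
  obtain ⟨hr, hr2⟩ := PauliNorm.expansionExponent_mem hd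
  refine ⟨⟨hr, hr2⟩, ?_⟩
  have hM : 0 ≤ PauliNorm.opNorm H := norm_nonneg _
  have hk1 : (1 : ℝ) ≤ k := by exact_mod_cast hk
  have hc1 : 1 ≤ c ^ (1 / (2 * (d : ℝ))) := Real.one_le_rpow hc (by positivity)
  have hnorm : PauliNorm.pauliNorm H (PauliNorm.expansionExponent d) ≤
      c ^ (1 / (2 * (d : ℝ))) *
        ((1 + 4 * k ^ 2 * 6 ^ (k - 1) * √3 ^ k) * PauliNorm.opNorm H) := by
    -- For `n < d` no set of `d` qubits exists, so `hexp` carries no information.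
    rcases le_or_gt d n with h | h
    · refine (PauliNorm.pauliNorm_le_of_le hd hc h hH hexp).trans ?_
      gcongr
      rw [add_mul, one_mul]
      gcongr
      exact PauliNorm.sum_sqrt_sum_norm_pauliCoeff_sq_le hH
    · refine (PauliNorm.pauliNorm_le_of_lt hd h hH).trans ?_
      refine le_trans ?_ (le_mul_of_one_le_left (by positivity) hc1)
      gcongr
      have h1 : (1 : ℝ) ≤ k ^ 2 * 6 ^ (k - 1) :=
        one_le_mul_of_one_le_of_one_le (one_le_pow₀ hk1) (one_le_pow₀ (by norm_num))
      have h2 : 0 ≤ √3 ^ k := by positivity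
      nlinarith [mul_le_mul_of_nonneg_right h1 h2]
  have hp : 1 / 2 ≤ 1 / PauliNorm.expansionExponent d :=
    one_div_le_one_div_of_le (by linarith) hr2.le
  have hconst := PauliNorm.const_le hk hp
  unfold PauliNorm.expansionConst
  set X := c ^ (1 / (2 * (d : ℝ)))
  set K := (k : ℝ) ^ ((k : ℝ) + 3 / 2 + 1 / PauliNorm.expansionExponent d)
  have hK : 0 < K := Real.rpow_pos_of_pos (by linarith) _
  set B := (√6 + 2 * √3) ^ k
  have hB : 0 < B := by positivity
  have hX : 0 < X := by linarith
  rw [one_div_mul_eq_div, div_div, div_mul_eq_mul_div, div_le_iff₀ (by positivity)]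
  refine (mul_le_mul_of_nonneg_left hnorm (Real.sqrt_nonneg _)).trans ?_
  calc √(2 * (k.factorial : ℝ)) * (X * ((1 + 4 * k ^ 2 * 6 ^ (k - 1) * √3 ^ k) *
        PauliNorm.opNorm H))
      = √(2 * (k.factorial : ℝ)) * (1 + 4 * k ^ 2 * 6 ^ (k - 1) * √3 ^ k) *
        (X * PauliNorm.opNorm H) := by ring
    _ ≤ 3 * (K * B) * (X * PauliNorm.opNorm H) :=
        mul_le_mul_of_nonneg_right hconst (by positivity)
    _ = PauliNorm.opNorm H * (X * K * B * 3) := by ring
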